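/- Let $\mathfrak g$ be a (finite-dimensional) complex semisimple Lie algebra, $\tau$ an involutive automorphism of $\mathfrak g$ (that is, $\tau^2=\mathrm{id}$), and $\mathfrak g^\tau=\{x\in\mathfrak g:\tau x=x\}$. Let $\mathfrak j\subset\mathfrak g$ be a Cartan subalgebra, $\Delta^+$ a positive system in the root system $\Delta(\mathfrak g,\mathfrak j)$, $\mathfrak n=\bigoplus_{\alpha\in\Delta^+}\mathfrak g_\alpha$, and suppose that the Borel subalgebra $\mathfrak b=\mathfrak j+\mathfrak n$ is $\tau$-stable, i.e. $\tau\mathfrak b=\mathfrak b$. Let $\mathcal O=\mathcal O^{\mathfrak b}$ be the BGG category of finitely generated $\mathfrak g$-modules that are $\mathfrak j$-semisimple and locally $\mathfrak n$-finite. Then for every simple $\mathfrak g$-module $X$ in $\mathcal O$ and every simple $\mathfrak g^\tau$-module $Y$, $$\dim\operatorname{Hom}_{\mathfrak g^\tau}(Y,X|_{\mathfrak g^\tau})<\infty .$$ Moreover, the multiplicity of $Y$ in $X|_{\mathfrak g^\tau}$ as a subquotient is finite: the supremum, over all finite chains $X_0\subseteq X_1\subseteq\dots\subseteq X_n$ of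 $\mathfrak g^\tau$-submodules of $X$, of the number of indices $i<n$ with $X_{i+1}/X_i\simeq Y$ as $\mathfrak g^\tau$-modules, is finite. -/

import Mathlib

noncomputable section

namespace BGG

section Borel

variable {𝔤 : Type*} [LieRing 𝔤] [LieAlgebra ℂ 𝔤]

/-- `α` belongs to the root system `Δ(𝔤, 𝔧)`: it is a nonzero linear functional on the Cartan
subalgebra `𝔧` and its root space is nonzero. -/
def IsRoot (𝔧 : LieSubalgebra ℂ 𝔤) [𝔧.IsCartanSubalgebra] (α : Module.Dual ℂ 𝔧) : Prop :=
  α ≠ 0 ∧ LieAlgebra.rootSpace 𝔧 α ≠ ⊥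

/-- A positive system `Δ⁺ ⊆ Δ(𝔤, 𝔧)`: a set of roots, closed under those sums that are roots, such
that for each root `α` exactly one of `α`, `-α` belongs to it. -/
structure PositiveSystem (𝔧 : LieSubalgebra ℂ 𝔤) [𝔧.IsCartanSubalgebra] where
  roots : Set (Module.Dual ℂ 𝔧)
  isRoot : ∀ α ∈ roots, IsRoot 𝔧 α
  mem_or_neg_mem : ∀ α, IsRoot 𝔧 α → α ∈ roots ∨ -α ∈ roots
  neg_notMem : ∀ α ∈ roots, -α ∉ roots
  add_mem_roots : ∀ α ∈ roots, ∀ β ∈ roots, IsRoot 𝔧 (α + β) → α + β ∈ roots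

variable {𝔧 : LieSubalgebra ℂ 𝔤} [𝔧.IsCartanSubalgebra]

/-- The sum of the positive root spaces, as a `𝔧`-submodule of `𝔤`. -/
def PositiveSystem.rootSum (P : PositiveSystem 𝔧) : LieSubmodule ℂ 𝔧 𝔤 :=
  ⨆ α ∈ P.roots, LieAlgebra.rootSpace 𝔧 α

theorem PositiveSystem.lie_mem_rootSum (P : PositiveSystem 𝔧) {x y : 𝔤}
    (hx : x ∈ P.rootSum) (hy : y ∈ P.rootSum) : ⁅x, y⁆ ∈ P.rootSum := by
  have key : ∀ α ∈ P.roots, ∀ β ∈ P.roots, ∀ x ∈ LieAlgebra.rootSpace 𝔧 α,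
      ∀ y ∈ LieAlgebra.rootSpace 𝔧 β, ⁅x, y⁆ ∈ P.rootSum := by
    intro α hα β hβ x hx y hy
    have hxy : ⁅x, y⁆ ∈ LieAlgebra.rootSpace 𝔧 (α + β : Module.Dual ℂ 𝔧) :=
      LieAlgebra.lie_mem_genWeightSpace_of_mem_genWeightSpace hx hy
    by_cases h0 : α + β = 0
    · exact absurd hβ (by rw [← neg_eq_of_add_eq_zero_right h0]; exact P.neg_notMem α hα)
    by_cases hb : LieAlgebra.rootSpace 𝔧 (α + β : Module.Dual ℂ 𝔧) = ⊥
    · rw [hb, LieSubmodule.mem_bot] at hxy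
      rw [hxy]
      exact zero_mem _
    · have hmem := P.add_mem_roots α hα β hβ ⟨h0, hb⟩
      exact (le_iSup₂_of_le (f := fun γ (_ : γ ∈ P.roots) => LieAlgebra.rootSpace 𝔧 γ)
        (α + β) hmem le_rfl) hxy
  have step : ∀ α ∈ P.roots, ∀ x ∈ LieAlgebra.rootSpace 𝔧 α, ⁅x, y⁆ ∈ P.rootSum := by
    intro α hα x hx
    have hle : P.rootSum.toSubmodule ≤
        P.rootSum.toSubmodule.comap (LieAlgebra.ad ℂ 𝔤 x : 𝔤 →ₗ[ℂ] 𝔤) := by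
      conv_lhs => rw [PositiveSystem.rootSum]
      simp only [LieSubmodule.iSup_toSubmodule]
      exact iSup₂_le fun β hβ z hz => key α hα β hβ x hx z hz
    exact hle hy
  have hle : P.rootSum.toSubmodule ≤
      P.rootSum.toSubmodule.comap (LieAlgebra.ad ℂ 𝔤 y : 𝔤 →ₗ[ℂ] 𝔤) := by
    conv_lhs => rw [PositiveSystem.rootSum]
    simp only [LieSubmodule.iSup_toSubmodule]
    refine iSup₂_le fun α hα z hz => ?_
    have h := step α hα z hz
    rw [← lie_skew] at h
    exact (neg_mem_iff (S := LieSubmodule ℂ 𝔧 𝔤)).mp h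
  have h := hle hx
  rw [← lie_skew]
  exact neg_mem (S := LieSubmodule ℂ 𝔧 𝔤) h

/-- The nilradical `𝔫 = ⨁_{α ∈ Δ⁺} 𝔤_α` of the Borel subalgebra defined by `(𝔧, Δ⁺)`. -/
def PositiveSystem.nilradical (P : PositiveSystem 𝔧) : LieSubalgebra ℂ 𝔤 where
  toSubmodule := P.rootSum.toSubmodule
  lie_mem' hx hy := P.lie_mem_rootSum hx hy

/-- The Borel subalgebra `𝔟 = 𝔧 + 𝔫` of `𝔤` defined by `(𝔧, Δ⁺)`. -/
def PositiveSystem.borel (P : PositiveSystem 𝔧) : LieSubalgebra ℂ 𝔤 where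
  toSubmodule := 𝔧.toSubmodule ⊔ P.nilradical.toSubmodule
  lie_mem' := by
    intro x y hx hy
    obtain ⟨a, ha, u, hu, rfl⟩ := Submodule.mem_sup.mp hx
    obtain ⟨b, hb, v, hv, rfl⟩ := Submodule.mem_sup.mp hy
    have h1 : ⁅a, b⁆ ∈ 𝔧.toSubmodule := 𝔧.lie_mem ha hb
    have h2 : ⁅a, v⁆ ∈ P.nilradical.toSubmodule := P.rootSum.lie_mem (x := ⟨a, ha⟩) hv
    have h3 : ⁅u, b⁆ ∈ P.nilradical.toSubmodule := by
      rw [← lie_skew]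
      exact neg_mem (S := LieSubmodule ℂ 𝔧 𝔤) (P.rootSum.lie_mem (x := ⟨b, hb⟩) hu)
    have h4 : ⁅u, v⁆ ∈ P.nilradical.toSubmodule := P.lie_mem_rootSum hu hv
    refine Submodule.mem_sup.mpr ⟨⁅a, b⁆, h1, ⁅a, v⁆ + (⁅u, b⁆ + ⁅u, v⁆),
      add_mem h2 (add_mem h3 h4), ?_⟩
    simp only [add_lie, lie_add]
    abel

/-- The `𝔤`-module `X` is an object of the BGG category `𝒪` attached to the Borel subalgebra
`𝔟 = 𝔧 + 𝔫`: it is finitely generated, `𝔧`-semisimple and locally `𝔫`-finite. -/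
structure CategoryO (P : PositiveSystem 𝔧) (X : Type*) [AddCommGroup X] [Module ℂ X]
    [LieRingModule 𝔤 X] [LieModule ℂ 𝔤 X] : Prop where
  finitelyGenerated : ∃ s : Finset X, LieSubmodule.lieSpan ℂ 𝔤 (s : Set X) = ⊤
  semisimple : ⨆ χ : Module.Dual ℂ 𝔧, LieModule.weightSpace X (χ : 𝔧 → ℂ) = ⊤
  locallyFinite : ∀ v : X,
    FiniteDimensional ℂ (LieSubmodule.lieSpan ℂ P.nilradical ({v} : Set X))

/-- The subalgebra `𝔤^τ = {x ∈ 𝔤 | τ x = x}`. -/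
def fixedSubalgebra (τ : 𝔤 ≃ₗ⁅ℂ⁆ 𝔤) : LieSubalgebra ℂ 𝔤 where
  carrier := {x | τ x = x}
  add_mem' {x y} (hx : τ x = x) (hy : τ y = y) := show τ (x + y) = x + y by rw [map_add, hx, hy]
  zero_mem' := show τ 0 = 0 from map_zero τ
  smul_mem' c x (hx : τ x = x) := show τ (c • x) = c • x by rw [map_smul, hx]
  lie_mem' {x y} (hx : τ x = x) (hy : τ y = y) := show τ ⁅x, y⁆ = ⁅x, y⁆ by
    rw [LieEquiv.map_lie, hx, hy]

end Borel

/-- The multiplicity of `Y` in `M` as a subquotient: the supremum, over all finite chains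
`F 0 ≤ F 1 ≤ ⋯ ≤ F n` of `L`-submodules of `M`, of the number of indices `i < n` for which
`F (i + 1) / F i` is isomorphic to `Y`. -/
def subquotientMultiplicity (L : Type*) [LieRing L] [LieAlgebra ℂ L]
    (Y : Type*) [AddCommGroup Y] [Module ℂ Y] [LieRingModule L Y] [LieModule ℂ L Y]
    (M : Type*) [AddCommGroup M] [Module ℂ M] [LieRingModule L M] [LieModule ℂ L M] : ℕ∞ :=
  ⨆ (n : ℕ) (F : Fin (n + 1) →o LieSubmodule ℂ L M),
    {i : Fin n | Nonempty
      ((↥(F i.succ) ⧸ (F i.castSucc).comap (F i.succ).incl) ≃ₗ⁅ℂ, L⁆ Y)}.encard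

end BGG

end

/-!
The whole statement follows from one element `z` of `𝔤^τ` that acts on `X` in a locally finite way
with finite-dimensional generalized eigenspaces. Indeed, if `v ∈ Y` is a nonzero generalized
eigenvector of `z` for `μ`, then evaluation at `v` embeds `Hom(Y, X)` into the generalized
`μ`-eigenspace `E` of `z` on `X`; and in a chain of submodules of `X` each subquotient isomorphic
to `Y` raises the dimension of the intersection with `E`, so that there are at most `dim E` of them
(`LieModuleHom.finiteDimensional_of_isLocallyFinite`, `BGG.subquotientMultiplicity_lt_top`).

Such a `z` is any element of `𝔟` that acts on `𝔤 / 𝔟` with eigenvalues of negative real part. The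
module `X` is generated by a finite-dimensional `𝔟`-stable subspace `V₀`, and `𝔟` preserves the
filtration `V₀ ≤ V₀ + 𝔤 V₀ ≤ ⋯`. Its successive quotients are quotients of
`(𝔤 / 𝔟) ⊗ ⋯ ⊗ (𝔤 / 𝔟) ⊗ V₀`, where the eigenvalues of `z` have real parts tending to `-∞`; hence
each generalized eigenspace lies in a step of the filtration
(`LieModule.isLocallyFinite_and_finiteDimensional`).

To find `z` in `𝔟 ∩ 𝔤^τ`, choose `h ∈ 𝔧` on which all positive roots have positive real part, and
put `z = h + τ h`. Since `τ` preserves `𝔟`, both `h` and `τ h` act on `𝔤 / 𝔟` with eigenvalues of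
negative real part, and so does their sum, because by Lie's theorem the solvable algebra `𝔟` acts
on `𝔤 / 𝔟` by triangular matrices
(`BGG.PositiveSystem.exists_fixed_sup_genEigenspaceReLE_eq_top`). For `h` one takes the sum of the
positive roots, transported to `𝔧` by the Killing form; that it is dominant regular is proved for an
abstract positive system by pairing roots through a reflection
(`BGG.PositiveSystem.sum_cartanInt_pos`).
-/

open Module

/-! ### Generalized eigenspaces of locally finite endomorphisms -/

namespace Module.End

variable {V : Type*} [AddCommGroup V] [Module ℂ V]

theorem le_iSup_inf_maxGenEigenspace (T : End ℂ V) (W : Submodule ℂ V) [FiniteDimensional ℂ W]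
    (hW : ∀ w ∈ W, T w ∈ W) : W ≤ ⨆ μ, W ⊓ T.maxGenEigenspace μ := by
  have h := iSup_maxGenEigenspace_eq_top (T.restrict hW)
  have h2 := congrArg (Submodule.map W.subtype) h
  rw [Submodule.map_iSup, Submodule.map_top, Submodule.range_subtype] at h2
  conv_lhs => rw [← h2]
  refine iSup_mono fun μ => ?_
  rw [maxGenEigenspace, genEigenspace_restrict]
  rintro _ ⟨w, hw, rfl⟩
  exact ⟨w.2, hw⟩

theorem map_pow_sub_smul_apply {V' : Type*} [AddCommGroup V'] [Module ℂ V'] {T : End ℂ V}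
    {T' : End ℂ V'} (f : V →ₗ[ℂ] V') (hf : ∀ v, f (T v) = T' (f v)) (μ : ℂ) (k : ℕ) (v : V) :
    f (((T - μ • 1) ^ k) v) = ((T' - μ • 1) ^ k) (f v) := by
  induction k generalizing v with
  | zero => simp
  | succ k ih => rw [pow_succ, pow_succ, mul_apply, mul_apply, ih]; simp [hf]

theorem apply_mem_maxGenEigenspace {V' : Type*} [AddCommGroup V'] [Module ℂ V'] {T : End ℂ V}
    {T' : End ℂ V'} (f : V →ₗ[ℂ] V') (hf : ∀ v, f (T v) = T' (f v)) {μ : ℂ} {v : V}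
    (hv : v ∈ T.maxGenEigenspace μ) : f v ∈ T'.maxGenEigenspace μ := by
  rw [mem_maxGenEigenspace] at hv ⊢
  obtain ⟨k, hk⟩ := hv
  refine ⟨k, ?_⟩
  rw [← map_pow_sub_smul_apply f hf, hk, map_zero]

theorem mem_maxGenEigenspace_of_injective {V' : Type*} [AddCommGroup V'] [Module ℂ V']
    {T : End ℂ V} {T' : End ℂ V'} (f : V →ₗ[ℂ] V') (hf : ∀ v, f (T v) = T' (f v))
    (hinj : Function.Injective f) {μ : ℂ} {v : V} (hv : f v ∈ T'.maxGenEigenspace μ) :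
    v ∈ T.maxGenEigenspace μ := by
  rw [mem_maxGenEigenspace] at hv ⊢
  obtain ⟨k, hk⟩ := hv
  refine ⟨k, hinj ?_⟩
  rw [map_pow_sub_smul_apply f hf, hk, map_zero]

/-- The sum of the generalized eigenspaces of `T` for the eigenvalues `μ` with `Re μ ≤ r`. -/
def genEigenspaceReLE (T : End ℂ V) (r : ℝ) : Submodule ℂ V :=
  ⨆ (μ : ℂ) (_ : μ.re ≤ r), T.maxGenEigenspace μ

theorem maxGenEigenspace_le_genEigenspaceReLE (T : End ℂ V) {μ : ℂ} {r : ℝ} (h : μ.re ≤ r) :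
    T.maxGenEigenspace μ ≤ T.genEigenspaceReLE r :=
  le_iSup₂_of_le (f := fun (μ : ℂ) (_ : μ.re ≤ r) => T.maxGenEigenspace μ) μ h le_rfl

theorem genEigenspaceReLE_mono (T : End ℂ V) {r s : ℝ} (h : r ≤ s) :
    T.genEigenspaceReLE r ≤ T.genEigenspaceReLE s :=
  iSup₂_le fun _ hμ => T.maxGenEigenspace_le_genEigenspaceReLE (hμ.trans h)

theorem disjoint_maxGenEigenspace_genEigenspaceReLE (T : End ℂ V) {μ : ℂ} {r : ℝ}
    (h : r < μ.re) : Disjoint (T.maxGenEigenspace μ) (T.genEigenspaceReLE r) :=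
  (T.independent_maxGenEigenspace μ).mono_right <|
    iSup_mono fun _ => iSup_mono' fun hν => ⟨fun hνμ => by subst hνμ; linarith, le_rfl⟩

theorem exists_le_genEigenspaceReLE (T : End ℂ V) (W : Submodule ℂ V) [FiniteDimensional ℂ W]
    (hW : ∀ w ∈ W, T w ∈ W) : ∃ r : ℝ, W ≤ T.genEigenspaceReLE r := by
  have hfin := finite_spectrum (T.restrict hW)
  obtain ⟨r, hr⟩ := (hfin.image Complex.re).bddAbove
  refine ⟨r, (le_iSup_inf_maxGenEigenspace T W hW).trans (iSup_le fun μ => ?_)⟩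
  by_cases hμ : μ ∈ spectrum ℂ (T.restrict hW)
  · exact inf_le_right.trans (T.maxGenEigenspace_le_genEigenspaceReLE (hr ⟨μ, hμ, rfl⟩))
  · rw [← hasEigenvalue_iff_mem_spectrum] at hμ
    rintro w ⟨hw, hwμ⟩
    have : (⟨w, hw⟩ : W) ∈ maxGenEigenspace (T.restrict hW) μ :=
      mem_maxGenEigenspace_of_injective W.subtype (fun _ => rfl) W.injective_subtype hwμ
    have hb : maxGenEigenspace (T.restrict hW) μ = ⊥ := by
      by_contra hne
      exact hμ (HasUnifEigenvalue.lt (k := ⊤) zero_lt_one hne)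
    rw [hb, Submodule.mem_bot] at this
    have : w = 0 := congrArg Subtype.val this
    rw [this]; exact zero_mem _

/-- A stable finite-dimensional subspace that together with the generalized eigenspaces of real
part at most `r` spans the whole space contains all generalized eigenspaces of real part above
`r`. -/
theorem maxGenEigenspace_le_of_sup_eq_top (T : End ℂ V) (W : Submodule ℂ V)
    [FiniteDimensional ℂ W] (hW : ∀ w ∈ W, T w ∈ W) {r : ℝ}
    (htop : W ⊔ T.genEigenspaceReLE r = ⊤) {μ : ℂ} (hμ : r < μ.re) :
    T.maxGenEigenspace μ ≤ W := by
  have h1 : W ≤ (W ⊓ T.maxGenEigenspace μ) ⊔ ⨆ (ν : ℂ) (_ : ν ≠ μ), T.maxGenEigenspace ν := by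
    refine (le_iSup_inf_maxGenEigenspace T W hW).trans (iSup_le fun ν => ?_)
    by_cases h : ν = μ
    · subst h; exact le_sup_left
    · exact le_sup_of_le_right (inf_le_right.trans
        (le_iSup₂_of_le (f := fun (ν : ℂ) (_ : ν ≠ μ) => T.maxGenEigenspace ν) ν h le_rfl))
  have h2 : T.genEigenspaceReLE r ≤ ⨆ (ν : ℂ) (_ : ν ≠ μ), T.maxGenEigenspace ν :=
    iSup_mono fun _ => iSup_mono' fun hν => ⟨fun hνμ => by subst hνμ; linarith, le_rfl⟩
  intro v hv
  have hv' : v ∈ W ⊔ T.genEigenspaceReLE r := htop ▸ Submodule.mem_top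
  obtain ⟨a, ha, b, hb, rfl⟩ := Submodule.mem_sup.mp
    ((sup_le h1 (le_sup_of_le_right h2)) hv')
  have hb0 : b = 0 := by
    have := (T.independent_maxGenEigenspace μ).le_bot
      ⟨(Submodule.add_mem_iff_right _ ha.2).mp hv, hb⟩
    simpa using this
  rw [hb0, add_zero]
  exact ha.1

/-- An endomorphism is locally finite if each vector lies in a stable finite-dimensional
subspace. -/
def IsLocallyFinite (T : End ℂ V) : Prop :=
  ∀ v, ∃ W : Submodule ℂ V, FiniteDimensional ℂ W ∧ (∀ w ∈ W, T w ∈ W) ∧ v ∈ W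

theorem IsLocallyFinite.le_iSup_inf_maxGenEigenspace {T : End ℂ V} (hT : T.IsLocallyFinite)
    (A : Submodule ℂ V) (hA : ∀ a ∈ A, T a ∈ A) : A ≤ ⨆ μ, A ⊓ T.maxGenEigenspace μ := by
  intro a ha
  obtain ⟨W, _, hW, haW⟩ := hT a
  have : FiniteDimensional ℂ ↥(W ⊓ A) := Submodule.finiteDimensional_of_le inf_le_left
  have h := T.le_iSup_inf_maxGenEigenspace (W ⊓ A) (fun w hw => ⟨hW w hw.1, hA w hw.2⟩) ⟨haW, ha⟩
  have hle : ⨆ μ, W ⊓ A ⊓ T.maxGenEigenspace μ ≤ ⨆ μ, A ⊓ T.maxGenEigenspace μ :=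
    iSup_mono fun μ => inf_le_inf_right _ inf_le_right
  exact hle h

end Module.End

/-! ### Homomorphisms and subquotient multiplicities -/

section SubquotientMultiplicity

open Module.End

variable {L : Type*} [LieRing L] [LieAlgebra ℂ L]
  {M : Type*} [AddCommGroup M] [Module ℂ M] [LieRingModule L M] [LieModule ℂ L M]
  {Y : Type*} [AddCommGroup Y] [Module ℂ Y] [LieRingModule L Y] [LieModule ℂ L Y]

/-- Homomorphisms out of a simple module are determined by their value at one generalized
eigenvector of `z`. -/
theorem LieModuleHom.finiteDimensional_of_isLocallyFinite
    [LieModule.IsIrreducible ℂ L Y] (z : L)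
    (hz : (LieModule.toEnd ℂ L M z).IsLocallyFinite)
    (hfd : ∀ μ, FiniteDimensional ℂ ((LieModule.toEnd ℂ L M z).maxGenEigenspace μ)) :
    FiniteDimensional ℂ (Y →ₗ⁅ℂ, L⁆ M) := by
  by_cases hex : ∃ f : Y →ₗ⁅ℂ, L⁆ M, f ≠ 0
  swap
  · push Not at hex
    have : Subsingleton (Y →ₗ⁅ℂ, L⁆ M) := ⟨fun f g => by rw [hex f, hex g]⟩
    infer_instance
  obtain ⟨f, hf⟩ := hex
  have hker : ∀ g : Y →ₗ⁅ℂ, L⁆ M, g.ker = ⊤ → g = 0 := fun g hg => by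
    ext y
    have : y ∈ g.ker := hg ▸ LieSubmodule.mem_top y
    simpa using this
  have hfinj : Function.Injective f := by
    rw [← LieModuleHom.ker_eq_bot]
    exact (eq_bot_or_eq_top f.ker).resolve_right fun h => hf (hker f h)
  obtain ⟨y, μ, hy0, hyμ⟩ : ∃ (y : Y) (μ : ℂ), y ≠ 0 ∧
      y ∈ (LieModule.toEnd ℂ L Y z).maxGenEigenspace μ := by
    by_contra! hno
    have hle := hz.le_iSup_inf_maxGenEigenspace f.range.toSubmodule
      (fun a ha => f.range.lie_mem ha)
    apply hf
    ext y
    have hbot : ⨆ μ, f.range.toSubmodule ⊓ (LieModule.toEnd ℂ L M z).maxGenEigenspace μ ≤ ⊥ := by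
      refine iSup_le fun μ => ?_
      rintro _ ⟨ha, haμ⟩
      obtain ⟨y, rfl⟩ := (LieModuleHom.mem_range f _).mp ha
      by_contra hy
      refine hno y μ (fun h => hy (by simp [h])) ?_
      exact mem_maxGenEigenspace_of_injective (f : Y →ₗ[ℂ] M)
        (fun v => by simp) hfinj haμ
    have := hbot (hle ((LieModuleHom.mem_range f _).mpr ⟨y, rfl⟩))
    simpa using this
  have := hfd μ
  -- Evaluation at `y` embeds the space of homomorphisms into a generalized eigenspace.
  let ev : (Y →ₗ⁅ℂ, L⁆ M) →ₗ[ℂ] (LieModule.toEnd ℂ L M z).maxGenEigenspace μ :=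
    { toFun := fun g => ⟨g y, apply_mem_maxGenEigenspace (T := LieModule.toEnd ℂ L Y z)
        (g : Y →ₗ[ℂ] M) (fun v => by simp) hyμ⟩
      map_add' := fun _ _ => rfl
      map_smul' := fun _ _ => rfl }
  refine FiniteDimensional.of_injective ev ((injective_iff_map_eq_zero ev).mpr fun g hg => ?_)
  have hgy : y ∈ g.ker := by
    have : g y = 0 := congrArg Subtype.val hg
    simpa using this
  refine hker g ((eq_bot_or_eq_top g.ker).resolve_left fun h => hy0 ?_)
  rw [h] at hgy
  simpa using hgy

/-- The map from `A` to a module isomorphic to `A / B`. -/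
def LieSubmodule.quotientHom (A B : LieSubmodule ℂ L M)
    (e : (↥A ⧸ B.comap A.incl) ≃ₗ⁅ℂ, L⁆ Y) : A →ₗ⁅ℂ, L⁆ Y :=
  e.toLieModuleHom.comp (LieSubmodule.Quotient.mk' (B.comap A.incl))

omit [LieModule ℂ L Y] in
theorem LieSubmodule.quotientHom_surjective (A B : LieSubmodule ℂ L M)
    (e : (↥A ⧸ B.comap A.incl) ≃ₗ⁅ℂ, L⁆ Y) : Function.Surjective (A.quotientHom B e) :=
  e.surjective.comp (LieSubmodule.Quotient.surjective_mk' _)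

omit [LieModule ℂ L Y] in
theorem LieSubmodule.quotientHom_eq_zero (A B : LieSubmodule ℂ L M)
    (e : (↥A ⧸ B.comap A.incl) ≃ₗ⁅ℂ, L⁆ Y) {a : A} (ha : (a : M) ∈ B) :
    A.quotientHom B e a = 0 := by
  have h : LieSubmodule.Quotient.mk' (B.comap A.incl) a = 0 := by
    rw [LieSubmodule.Quotient.mk_eq_zero]; exact ha
  rw [LieSubmodule.quotientHom, LieModuleHom.comp_apply, h, map_zero]

/-- To check where a homomorphism sends a submodule it suffices to look at generalized
eigenvectors of `z`. -/
theorem LieSubmodule.apply_mem_of_isLocallyFinite (z : L)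
    (hz : (LieModule.toEnd ℂ L M z).IsLocallyFinite) (A : LieSubmodule ℂ L M)
    (π : A →ₗ⁅ℂ, L⁆ Y) {N : Submodule ℂ Y}
    (hN : ∀ μ, ∀ a : A, (a : M) ∈ (LieModule.toEnd ℂ L M z).maxGenEigenspace μ →
      π a ∈ (LieModule.toEnd ℂ L Y z).maxGenEigenspace μ → π a ∈ N) (a : A) : π a ∈ N := by
  have hle : A.toSubmodule ≤
      Submodule.map A.toSubmodule.subtype (Submodule.comap (π : A →ₗ[ℂ] Y) N) := by
    refine (hz.le_iSup_inf_maxGenEigenspace A.toSubmodule fun a ha => A.lie_mem ha).trans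
      (iSup_le fun ν => ?_)
    rintro a ⟨haA, haν⟩
    refine ⟨⟨a, haA⟩, hN ν ⟨a, haA⟩ haν ?_, rfl⟩
    refine apply_mem_maxGenEigenspace (T := LieModule.toEnd ℂ L A z) (π : A →ₗ[ℂ] Y)
      (fun v => by simp) ?_
    exact mem_maxGenEigenspace_of_injective A.toSubmodule.subtype (fun _ => rfl)
      A.toSubmodule.injective_subtype haν
  obtain ⟨a', ha', haa'⟩ := hle a.2
  have haa : a' = a := Subtype.ext haa'
  subst haa
  exact ha'

/-- A generalized eigenvalue of `z` on a subquotient of `M` is attained on each pair of submodules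
realizing that subquotient. -/
theorem LieSubmodule.exists_mem_maxGenEigenspace_notMem (z : L)
    (hz : (LieModule.toEnd ℂ L M z).IsLocallyFinite) {μ : ℂ}
    (hμ : (LieModule.toEnd ℂ L Y z).maxGenEigenspace μ ≠ ⊥) (A B : LieSubmodule ℂ L M)
    (e : (↥A ⧸ B.comap A.incl) ≃ₗ⁅ℂ, L⁆ Y) :
    ∃ a ∈ A, a ∈ (LieModule.toEnd ℂ L M z).maxGenEigenspace μ ∧ a ∉ B := by
  by_contra! hcon
  have key := A.apply_mem_of_isLocallyFinite z hz (A.quotientHom B e)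
    (N := ⨆ (ν : ℂ) (_ : ν ≠ μ), (LieModule.toEnd ℂ L Y z).maxGenEigenspace ν) (by
      intro ν a haν hν
      by_cases h : ν = μ
      · subst h
        rw [A.quotientHom_eq_zero B e (hcon a a.2 haν)]
        exact zero_mem _
      · exact le_iSup₂_of_le (f := fun (ν : ℂ) (_ : ν ≠ μ) =>
          (LieModule.toEnd ℂ L Y z).maxGenEigenspace ν) ν h le_rfl hν)
  obtain ⟨y, hy, hy0⟩ := Submodule.exists_mem_ne_zero_of_ne_bot hμ
  obtain ⟨a, rfl⟩ := A.quotientHom_surjective B e y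
  exact hy0 (by simpa using
    ((LieModule.toEnd ℂ L Y z).independent_maxGenEigenspace μ).le_bot ⟨hy, key a⟩)

theorem LieSubmodule.exists_maxGenEigenspace_ne_bot [Nontrivial Y] (z : L)
    (hz : (LieModule.toEnd ℂ L M z).IsLocallyFinite) (A B : LieSubmodule ℂ L M)
    (e : (↥A ⧸ B.comap A.incl) ≃ₗ⁅ℂ, L⁆ Y) :
    ∃ μ, (LieModule.toEnd ℂ L Y z).maxGenEigenspace μ ≠ ⊥ := by
  by_contra! hno
  obtain ⟨y, hy⟩ := exists_ne (0 : Y)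
  obtain ⟨a, rfl⟩ := A.quotientHom_surjective B e y
  have key := A.apply_mem_of_isLocallyFinite z hz (A.quotientHom B e) (N := ⊥)
    (fun μ a _ h => by rwa [hno μ] at h) a
  exact hy ((Submodule.mem_bot ℂ).mp key)

/-- Along a chain, each factor isomorphic to `Y` uses up at least one dimension of a fixed
generalized eigenspace of `z`. -/
theorem BGG.subquotientMultiplicity_lt_top [LieModule.IsIrreducible ℂ L Y] (z : L)
    (hz : (LieModule.toEnd ℂ L M z).IsLocallyFinite)
    (hfd : ∀ μ, FiniteDimensional ℂ ((LieModule.toEnd ℂ L M z).maxGenEigenspace μ)) :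
    BGG.subquotientMultiplicity L Y M < ⊤ := by
  by_cases hex : ∃ μ, (LieModule.toEnd ℂ L Y z).maxGenEigenspace μ ≠ ⊥
  swap
  · have : Nontrivial Y := (LieSubmodule.nontrivial_iff ℂ L Y).mp inferInstance
    refine lt_of_le_of_lt (iSup₂_le fun n F => ?_) ENat.top_pos
    rw [nonpos_iff_eq_zero, Set.encard_eq_zero, Set.eq_empty_iff_forall_notMem]
    rintro i ⟨e⟩
    exact hex (LieSubmodule.exists_maxGenEigenspace_ne_bot z hz _ _ e)
  obtain ⟨μ, hμ⟩ := hex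
  have := hfd μ
  set E := (LieModule.toEnd ℂ L M z).maxGenEigenspace μ
  refine lt_of_le_of_lt ?_ (ENat.natCast_lt_top (finrank ℂ E))
  refine iSup₂_le fun n F => ?_
  set S := {i : Fin n | Nonempty
      ((↥(F i.succ) ⧸ (F i.castSucc).comap (F i.succ).incl) ≃ₗ⁅ℂ, L⁆ Y)}
  -- Each factor isomorphic to `Y` makes the dimension `d` of the trace on `E` jump.
  let d : Fin (n + 1) → ℕ := fun j => finrank ℂ ↥((F j).toSubmodule ⊓ E)
  have hfin : ∀ j, FiniteDimensional ℂ ↥((F j).toSubmodule ⊓ E) := fun j =>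
    Submodule.finiteDimensional_of_le inf_le_right
  have hmono : Monotone d := fun i j hij =>
    Submodule.finrank_mono (inf_le_inf_right _ (F.monotone hij))
  have hjump : ∀ i ∈ S, d i.castSucc < d i.succ := by
    rintro i ⟨e⟩
    obtain ⟨a, haA, haE, haB⟩ :=
      LieSubmodule.exists_mem_maxGenEigenspace_notMem z hz hμ _ _ e
    refine Submodule.finrank_lt_finrank_of_lt (lt_of_le_of_ne
      (inf_le_inf_right _ (F.monotone i.castSucc_lt_succ.le)) fun h => haB ?_)
    have ha : a ∈ (F i.succ).toSubmodule ⊓ E := ⟨haA, haE⟩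
    rw [← h] at ha
    exact ha.1
  have hmaps : Set.MapsTo (fun i : Fin n => d i.castSucc) S (Finset.range (finrank ℂ E)) := by
    intro i hi
    exact Finset.mem_coe.mpr (Finset.mem_range.mpr
      ((hjump i hi).trans_le (Submodule.finrank_mono inf_le_right)))
  have hinj : Set.InjOn (fun i : Fin n => d i.castSucc) S := by
    have hlt : ∀ i ∈ S, ∀ j, i < j → d i.castSucc < d j.castSucc := fun i hi j hij =>
      (hjump i hi).trans_le (hmono (Fin.succ_le_castSucc_iff.mpr hij))
    intro i hi j hj hij
    rcases lt_trichotomy i j with h | h | h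
    · exact absurd hij (hlt i hi j h).ne
    · exact h
    · exact absurd hij (hlt j hj i h).ne'
  calc S.encard ≤ (Finset.range (finrank ℂ E) : Set ℕ).encard :=
        Set.encard_le_encard_of_injOn hmaps hinj
    _ = finrank ℂ E := by rw [Set.encard_coe_eq_coe_finsetCard, Finset.card_range]

end SubquotientMultiplicity

/-! ### The filtration of a Lie module by words -/

section LieFiltration

open Module.End

variable {L : Type*} [LieRing L] [LieAlgebra ℂ L]
  {M : Type*} [AddCommGroup M] [Module ℂ M] [LieRingModule L M] [LieModule ℂ L M]

theorem LieModule.lie_mem_genEigenspaceReLE (z : L) {r s : ℝ} {y : L} {m : M}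
    (hy : y ∈ (toEnd ℂ L L z).genEigenspaceReLE r)
    (hm : m ∈ (toEnd ℂ L M z).genEigenspaceReLE s) :
    ⁅y, m⁆ ∈ (toEnd ℂ L M z).genEigenspaceReLE (r + s) := by
  have h1 : ∀ μ : ℂ, μ.re ≤ r → ∀ y ∈ (toEnd ℂ L L z).maxGenEigenspace μ,
      ⁅y, m⁆ ∈ (toEnd ℂ L M z).genEigenspaceReLE (r + s) := by
    intro μ hμ y hy
    have hle : (toEnd ℂ L M z).genEigenspaceReLE s ≤
        ((toEnd ℂ L M z).genEigenspaceReLE (r + s)).comap (toEnd ℂ L M y) := by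
      refine iSup₂_le fun ν hν m hm => ?_
      refine maxGenEigenspace_le_genEigenspaceReLE _ (μ := μ + ν) ?_
        (lie_mem_maxGenEigenspace_toEnd hy hm)
      rw [Complex.add_re]; exact add_le_add hμ hν
    exact hle hm
  have hle : (toEnd ℂ L L z).genEigenspaceReLE r ≤
      ((toEnd ℂ L M z).genEigenspaceReLE (r + s)).comap
        ((toEnd ℂ L M : L →ₗ[ℂ] End ℂ M).flip m) :=
    iSup₂_le fun μ hμ y hy => h1 μ hμ y hy
  exact hle hy

variable (L) in
/-- The increasing filtration `V₀ ≤ V₀ + L V₀ ≤ V₀ + L V₀ + L L V₀ ≤ ⋯` of a Lie module. -/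
def LieModule.wordFiltration (V₀ : Submodule ℂ M) : ℕ → Submodule ℂ M
  | 0 => V₀
  | k + 1 => wordFiltration V₀ k ⊔
      Submodule.map₂ (toEnd ℂ L M : L →ₗ[ℂ] End ℂ M) ⊤ (wordFiltration V₀ k)

namespace LieModule

variable (V₀ : Submodule ℂ M)

theorem wordFiltration_le_succ (k : ℕ) : wordFiltration L V₀ k ≤ wordFiltration L V₀ (k + 1) :=
  le_sup_left

theorem wordFiltration_mono : Monotone (wordFiltration L V₀) :=
  monotone_nat_of_le_succ (wordFiltration_le_succ V₀)

theorem lie_mem_wordFiltration_succ {k : ℕ} (x : L) {m : M} (hm : m ∈ wordFiltration L V₀ k) :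
    ⁅x, m⁆ ∈ wordFiltration L V₀ (k + 1) :=
  le_sup_right (a := wordFiltration L V₀ k)
    (Submodule.apply_mem_map₂ (toEnd ℂ L M : L →ₗ[ℂ] End ℂ M) (Submodule.mem_top (x := x)) hm)

instance [FiniteDimensional ℂ L] [FiniteDimensional ℂ V₀] (k : ℕ) :
    FiniteDimensional ℂ (wordFiltration L V₀ k) := by
  induction k with
  | zero => assumption
  | succ k ih =>
    rw [wordFiltration]
    have : FiniteDimensional ℂ ↥(Submodule.map₂ (toEnd ℂ L M : L →ₗ[ℂ] End ℂ M) ⊤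
        (wordFiltration L V₀ k)) :=
      Module.Finite.iff_fg.mpr
        (Submodule.FG.map₂ _ Module.Finite.fg_top (Module.Finite.iff_fg.mp ih))
    infer_instance

theorem wordFiltration_succ_le {k : ℕ} {N : Submodule ℂ M} (h : wordFiltration L V₀ k ≤ N)
    (h' : ∀ x : L, ∀ m ∈ wordFiltration L V₀ k, ⁅x, m⁆ ∈ N) : wordFiltration L V₀ (k + 1) ≤ N :=
  sup_le h (Submodule.map₂_le.mpr fun x _ m hm => h' x m hm)

theorem exists_mem_wordFiltration (hgen : LieSubmodule.lieSpan ℂ L (V₀ : Set M) = ⊤) (m : M) :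
    ∃ k, m ∈ wordFiltration L V₀ k := by
  let N : LieSubmodule ℂ L M :=
    { toSubmodule := ⨆ k, wordFiltration L V₀ k
      lie_mem := by
        intro x m hm
        obtain ⟨k, hk⟩ := (Submodule.mem_iSup_of_directed _
          (wordFiltration_mono V₀).directed_le).mp hm
        exact Submodule.mem_iSup_of_mem (k + 1) (lie_mem_wordFiltration_succ V₀ x hk) }
  have hN : LieSubmodule.lieSpan ℂ L (V₀ : Set M) ≤ N :=
    LieSubmodule.lieSpan_le.mpr fun v hv => Submodule.mem_iSup_of_mem 0 hv
  rw [hgen] at hN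
  exact (Submodule.mem_iSup_of_directed _ (wordFiltration_mono V₀).directed_le).mp
    (hN (LieSubmodule.mem_top m))

variable {V₀} (B : LieSubalgebra ℂ L) (hV₀ : ∀ b ∈ B, ∀ v ∈ V₀, ⁅b, v⁆ ∈ V₀)

include hV₀ in
theorem lie_mem_wordFiltration (k : ℕ) {b : L} (hb : b ∈ B) {v : M}
    (hv : v ∈ wordFiltration L V₀ k) : ⁅b, v⁆ ∈ wordFiltration L V₀ k := by
  induction k generalizing b v with
  | zero => exact hV₀ b hb v hv
  | succ k ih =>
    have hle : wordFiltration L V₀ (k + 1) ≤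
        (wordFiltration L V₀ (k + 1)).comap (toEnd ℂ L M b) := by
      refine wordFiltration_succ_le V₀ (fun v hv => wordFiltration_le_succ V₀ k (ih hb hv)) ?_
      intro x m hm
      change ⁅b, ⁅x, m⁆⁆ ∈ wordFiltration L V₀ (k + 1)
      rw [leibniz_lie]
      exact add_mem (lie_mem_wordFiltration_succ V₀ _ hm)
        (lie_mem_wordFiltration_succ V₀ _ (ih hb hm))
    exact hle hv

/-- Passing from one step of the filtration to the next lowers the real part of the
eigenvalues of `z` on the successive quotients by at least `δ`. -/
theorem wordFiltration_succ_le_sup {z : L} {δ c : ℝ}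
    (hz : B.toSubmodule ⊔ (toEnd ℂ L L z).genEigenspaceReLE (-δ) = ⊤)
    (hV₀ : ∀ b ∈ B, ∀ v ∈ V₀, ⁅b, v⁆ ∈ V₀)
    (hc : V₀ ≤ (toEnd ℂ L M z).genEigenspaceReLE c) (k : ℕ) :
    wordFiltration L V₀ (k + 1) ≤
      wordFiltration L V₀ k ⊔ (toEnd ℂ L M z).genEigenspaceReLE (c - (k + 1) * δ) := by
  -- `N` plays the previous step of the filtration, which is zero before the first one.
  have step : ∀ (k : ℕ) (N : Submodule ℂ M) (r : ℝ), N ≤ wordFiltration L V₀ k →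
      (∀ x : L, ∀ m ∈ N, ⁅x, m⁆ ∈ wordFiltration L V₀ k) →
      wordFiltration L V₀ k ≤ N ⊔ (toEnd ℂ L M z).genEigenspaceReLE r →
      wordFiltration L V₀ (k + 1) ≤
        wordFiltration L V₀ k ⊔ (toEnd ℂ L M z).genEigenspaceReLE (r - δ) := by
    intro k N r hN hLN hle
    refine wordFiltration_succ_le V₀ le_sup_left fun x m hm => ?_
    have hx : x ∈ B.toSubmodule ⊔ (toEnd ℂ L L z).genEigenspaceReLE (-δ) :=
      hz ▸ Submodule.mem_top
    obtain ⟨b, hb, y, hy, rfl⟩ := Submodule.mem_sup.mp hx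
    rw [add_lie]
    refine add_mem (le_sup_left (a := wordFiltration L V₀ k)
      (lie_mem_wordFiltration B hV₀ k hb hm)) ?_
    obtain ⟨n, hn, g, hg, rfl⟩ := Submodule.mem_sup.mp (hle hm)
    rw [lie_add]
    refine Submodule.add_mem_sup (hLN y n hn) ?_
    have := lie_mem_genEigenspaceReLE z hy hg
    rwa [neg_add_eq_sub] at this
  induction k with
  | zero =>
    have := step 0 ⊥ c bot_le (by simp) (by rw [bot_sup_eq]; exact hc)
    simpa using this
  | succ k ih =>
    have := step (k + 1) (wordFiltration L V₀ k) _ (wordFiltration_le_succ V₀ k)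
      (fun x m hm => lie_mem_wordFiltration_succ V₀ x hm) ih
    convert this using 3
    push_cast
    ring

/-- If `L` is spanned by `B` and generalized eigenvectors of `ad z`, `z ∈ B`, with negative
eigenvalues, then `z` acts on every `L`-module generated by a finite-dimensional `B`-stable
subspace in a locally finite way, with finite-dimensional generalized eigenspaces. -/
theorem isLocallyFinite_and_finiteDimensional [FiniteDimensional ℂ L] [FiniteDimensional ℂ V₀]
    {z : L} (hzB : z ∈ B) {δ : ℝ} (hδ : 0 < δ)
    (hz : B.toSubmodule ⊔ (toEnd ℂ L L z).genEigenspaceReLE (-δ) = ⊤)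
    (hV₀ : ∀ b ∈ B, ∀ v ∈ V₀, ⁅b, v⁆ ∈ V₀)
    (hgen : LieSubmodule.lieSpan ℂ L (V₀ : Set M) = ⊤) :
    (toEnd ℂ L M z).IsLocallyFinite ∧
      ∀ μ, FiniteDimensional ℂ ((toEnd ℂ L M z).maxGenEigenspace μ) := by
  refine ⟨fun m => ?_, fun μ => ?_⟩
  · obtain ⟨k, hk⟩ := exists_mem_wordFiltration V₀ hgen m
    exact ⟨_, inferInstance, fun w hw => lie_mem_wordFiltration B hV₀ k hzB hw, hk⟩
  · obtain ⟨c, hc⟩ := exists_le_genEigenspaceReLE (toEnd ℂ L M z) V₀ (fun v hv => hV₀ z hzB v hv)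
    obtain ⟨k, hk⟩ := exists_nat_gt ((c - μ.re) / δ)
    rw [div_lt_iff₀ hδ] at hk
    have hle : ∀ j, wordFiltration L V₀ (k + j) ≤
        wordFiltration L V₀ k ⊔ (toEnd ℂ L M z).genEigenspaceReLE (c - (k + 1) * δ) := by
      intro j
      induction j with
      | zero => exact le_sup_left
      | succ j ih =>
        refine (wordFiltration_succ_le_sup B hz hV₀ hc (k + j)).trans
          (sup_le ih (le_sup_of_le_right (genEigenspaceReLE_mono _ ?_)))
        push_cast
        nlinarith [(Nat.cast_nonneg j : (0 : ℝ) ≤ j)]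
    have htop : wordFiltration L V₀ k ⊔
        (toEnd ℂ L M z).genEigenspaceReLE (c - (k + 1) * δ) = ⊤ := by
      rw [eq_top_iff]
      intro m _
      obtain ⟨i, hi⟩ := exists_mem_wordFiltration V₀ hgen m
      exact hle i (wordFiltration_mono V₀ (Nat.le_add_left i k) hi)
    exact Submodule.finiteDimensional_of_le (maxGenEigenspace_le_of_sup_eq_top _ _
      (fun w hw => lie_mem_wordFiltration B hV₀ k hzB hw) htop (by linarith))

end LieModule

end LieFiltration

/-! ### Sums of elements of a solvable Lie algebra -/

section LieTheorem

theorem Module.End.HasEigenvalue.of_surjective {V V' : Type*} [AddCommGroup V] [Module ℂ V]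
    [AddCommGroup V'] [Module ℂ V'] [FiniteDimensional ℂ V] [FiniteDimensional ℂ V']
    {T : End ℂ V} {T' : End ℂ V'} (f : V →ₗ[ℂ] V') (hf : ∀ v, f (T v) = T' (f v))
    (hsurj : Function.Surjective f) {μ : ℂ} (h : T'.HasEigenvalue μ) : T.HasEigenvalue μ := by
  by_contra hT
  have hker : LinearMap.ker (T - μ • (1 : End ℂ V)) = ⊥ := by
    rw [← End.eigenspace_def]
    by_contra hne
    exact hT hne
  have hs : Function.Surjective (T - μ • (1 : End ℂ V)) :=
    LinearMap.injective_iff_surjective.mp (LinearMap.ker_eq_bot.mp hker)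
  have hs' : Function.Surjective (T' - μ • (1 : End ℂ V')) := by
    intro v'
    obtain ⟨v, rfl⟩ := hsurj v'
    obtain ⟨w, rfl⟩ := hs v
    exact ⟨f w, by simp [hf]⟩
  have hi' := LinearMap.ker_eq_bot.mpr (LinearMap.injective_iff_surjective.mpr hs')
  rw [← End.eigenspace_def] at hi'
  exact h hi'

open LieModule in
/-- For a solvable Lie algebra, the elements acting with eigenvalues of negative real part are
closed under addition: by Lie's theorem the action is triangular. -/
theorem LieModule.re_neg_of_hasEigenvalue_add (B : Type*) [LieRing B] [LieAlgebra ℂ B]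
    [LieAlgebra.IsSolvable B] (x y : B) (M : Type*) [AddCommGroup M] [Module ℂ M]
    [LieRingModule B M] [LieModule ℂ B M] [FiniteDimensional ℂ M]
    (hx : ∀ μ, (toEnd ℂ B M x).HasEigenvalue μ → μ.re < 0)
    (hy : ∀ μ, (toEnd ℂ B M y).HasEigenvalue μ → μ.re < 0)
    (μ : ℂ) (hμ : (toEnd ℂ B M (x + y)).HasEigenvalue μ) : μ.re < 0 := by
  obtain ⟨v, hv⟩ := hμ.exists_hasEigenvector
  have : Nontrivial M := ⟨v, 0, hv.2⟩
  obtain ⟨χ, hχ⟩ := exists_nontrivial_weightSpace_of_isSolvable ℂ B M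
  obtain ⟨⟨w, hw⟩, hw0⟩ := exists_ne (0 : weightSpace M χ)
  rw [mem_weightSpace] at hw
  have hw0 : w ≠ 0 := fun h => hw0 (by simp [h])
  have heig : ∀ b : B, (toEnd ℂ B M b).HasEigenvalue (χ b) := fun b =>
    End.hasEigenvalue_of_hasEigenvector ⟨End.mem_eigenspace_iff.mpr (hw b), hw0⟩
  let N : LieSubmodule ℂ B M :=
    { toSubmodule := Submodule.span ℂ {w}
      lie_mem := by
        intro b m hm
        obtain ⟨c, rfl⟩ := Submodule.mem_span_singleton.mp hm
        change ⁅b, c • w⁆ ∈ Submodule.span ℂ {w}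
        rw [lie_smul, hw]
        exact Submodule.smul_mem _ _
          (Submodule.smul_mem _ _ (Submodule.mem_span_singleton_self w)) }
  have hwN : w ∈ N := Submodule.mem_span_singleton_self w
  -- `μ` is the value of the character `χ` at `x + y` if `v` lies on the invariant line `N`, and
  -- otherwise an eigenvalue on the quotient by `N`, where induction on the dimension applies.
  by_cases hvN : v ∈ N
  · obtain ⟨c, rfl⟩ := Submodule.mem_span_singleton.mp hvN
    have h1 : ⁅x + y, c • w⁆ = μ • (c • w) := hv.apply_eq_smul
    rw [lie_smul, hw, smul_comm] at h1
    have h2 : χ (x + y) = μ := smul_left_injective ℂ hv.2 h1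
    rw [← h2, map_add, Complex.add_re]
    exact add_neg (hx _ (heig x)) (hy _ (heig y))
  · have hlt : finrank ℂ (M ⧸ N) < finrank ℂ M := by
      have h1 := Submodule.finrank_quotient_add_finrank N.toSubmodule
      have h2 : 0 < finrank ℂ N.toSubmodule :=
        Module.finrank_pos_iff.mpr ⟨⟨w, hwN⟩, 0, fun h => hw0 (congrArg Subtype.val h)⟩
      change finrank ℂ (M ⧸ N.toSubmodule) < _
      omega
    have hq : ∀ b : B, ∀ ν, (toEnd ℂ B (M ⧸ N) b).HasEigenvalue ν →
        (toEnd ℂ B M b).HasEigenvalue ν := fun b ν =>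
      End.HasEigenvalue.of_surjective (LieSubmodule.Quotient.mk' N : M →ₗ[ℂ] M ⧸ N)
        (fun v => by simp) (LieSubmodule.Quotient.surjective_mk' N)
    refine re_neg_of_hasEigenvalue_add B x y (M ⧸ N) (fun ν hν => hx ν (hq x ν hν))
      (fun ν hν => hy ν (hq y ν hν)) μ (End.hasEigenvalue_of_hasEigenvector
        (x := LieSubmodule.Quotient.mk' N v) ⟨End.mem_eigenspace_iff.mpr ?_, fun h => hvN ?_⟩)
    · have h1 : ⁅x + y, v⁆ = μ • v := hv.apply_eq_smul
      rw [toEnd_apply_apply, ← LieModuleHom.map_lie, h1, map_smul]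
    · rwa [LieSubmodule.Quotient.mk_eq_zero] at h
termination_by finrank ℂ M

end LieTheorem

/-! ### A regular dominant element of the Cartan subalgebra -/

namespace BGG

section PositiveSystem

open LieAlgebra LieAlgebra.IsKilling LieModule

variable {𝔤 : Type*} [LieRing 𝔤] [LieAlgebra ℂ 𝔤] [FiniteDimensional ℂ 𝔤] [IsKilling ℂ 𝔤]
  {𝔧 : LieSubalgebra ℂ 𝔤} [𝔧.IsCartanSubalgebra]

/-- A root, as a weight of the `𝔧`-module `𝔤`. -/
def IsRoot.weight {α : Dual ℂ 𝔧} (h : IsRoot 𝔧 α) : Weight ℂ 𝔧 𝔤 := ⟨α, h.2⟩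

omit [IsKilling ℂ 𝔤] in
theorem isRoot_toLinear_iff (w : Weight ℂ 𝔧 𝔤) : IsRoot 𝔧 w.toLinear ↔ w.IsNonZero := by
  have h0 : w.toLinear = 0 ↔ w.IsZero := Weight.coe_toLinear_eq_zero_iff
  exact ⟨fun h => fun h' => h.1 (h0.mpr h'), fun h => ⟨fun h' => h (h0.mp h'), w.2⟩⟩

/-- The integer `⟨β, α^∨⟩`, read off from the ends of the `α`-string through `β`. -/
noncomputable def cartanInt (α β : Weight ℂ 𝔧 𝔤) : ℤ := chainBotCoeff α β - chainTopCoeff α β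

theorem apply_coroot_eq_cartanInt (α β : Weight ℂ 𝔧 𝔤) : β (coroot α) = cartanInt α β :=
  apply_coroot_eq_cast α β

/-- A positive system contains the part of an `α`-string above any of its members, `α` being
positive. The string cannot pass through `0`, since `-α` is not positive. -/
theorem PositiveSystem.add_nsmul_mem_roots (P : PositiveSystem 𝔧) (α β : Weight ℂ 𝔧 𝔤)
    (hα : α.toLinear ∈ P.roots) (hβ : β.toLinear ∈ P.roots) (i : ℕ)
    (hi : i ≤ chainTopCoeff α β) : β.toLinear + i • α.toLinear ∈ P.roots := by
  have hα0 := (isRoot_toLinear_iff α).mp (P.isRoot _ hα)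
  induction i with
  | zero => simpa using hβ
  | succ i ih =>
    have hγ := ih (by omega)
    have heq : β.toLinear + (i + 1) • α.toLinear = (β.toLinear + i • α.toLinear) + α.toLinear := by
      rw [succ_nsmul, add_assoc]
    rw [heq]
    refine P.add_mem_roots _ hγ _ hα ⟨fun h => ?_, ?_⟩
    · exact P.neg_notMem _ hγ (by rwa [← eq_neg_of_add_eq_zero_right h])
    · have := (rootSpace_zsmul_add_ne_bot_iff α β hα0 (i + 1 : ℕ)).mpr
        ⟨by exact_mod_cast hi, by omega⟩
      rw [← heq]
      have hcoe : ⇑((β.toLinear : Dual ℂ 𝔧) + (i + 1) • (α.toLinear : Dual ℂ 𝔧)) =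
          ((i + 1 : ℕ) : ℤ) • (α : 𝔧 → ℂ) + (β : 𝔧 → ℂ) := by
        ext x
        simp [add_comm]
      rwa [hcoe]

theorem PositiveSystem.reflectRoot_mem_roots (P : PositiveSystem 𝔧) (α β : Weight ℂ 𝔧 𝔤)
    (hα : α.toLinear ∈ P.roots) (hβ : β.toLinear ∈ P.roots)
    (h : chainBotCoeff α β < chainTopCoeff α β) :
    (reflectRoot α β).toLinear ∈ P.roots := by
  convert P.add_nsmul_mem_roots α β hα hβ (chainTopCoeff α β - chainBotCoeff α β) (by omega) using 1
  ext x
  have : reflectRoot α β x = β x - β (coroot α) * α x := rfl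
  rw [Weight.toLinear_apply, this, apply_coroot_eq_cast]
  simp [Nat.cast_sub h.le]
  ring

open Classical in
/-- The positive roots, as a finite set of weights. -/
noncomputable def PositiveSystem.weights (P : PositiveSystem 𝔧) : Finset (Weight ℂ 𝔧 𝔤) :=
  Finset.univ.filter fun w => w.toLinear ∈ P.roots

omit [IsKilling ℂ 𝔤] in
theorem PositiveSystem.mem_weights (P : PositiveSystem 𝔧) {w : Weight ℂ 𝔧 𝔤} :
    w ∈ P.weights ↔ w.toLinear ∈ P.roots := by
  simp [weights]

theorem reflectRoot_apply_coroot (α β : Weight ℂ 𝔧 𝔤) (hα : α.IsNonZero) :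
    reflectRoot α β (coroot α) = -β (coroot α) := by
  have : reflectRoot α β (coroot α) = β (coroot α) - β (coroot α) * α (coroot α) := rfl
  rw [this, root_apply_coroot hα]
  ring

theorem reflectRoot_injective (α : Weight ℂ 𝔧 𝔤) (hα : α.IsNonZero) :
    Function.Injective (reflectRoot α) := by
  intro β γ h
  have h1 : β (coroot α) = γ (coroot α) := by
    rw [← neg_inj, ← reflectRoot_apply_coroot α β hα, ← reflectRoot_apply_coroot α γ hα, h]
  ext x
  have h2 : β x - β (coroot α) * α x = γ x - γ (coroot α) * α x :=
    congrArg (fun w : Weight ℂ 𝔧 𝔤 => w x) h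
  rw [h1] at h2
  exact sub_left_injective h2

theorem cartanInt_reflectRoot (α β : Weight ℂ 𝔧 𝔤) (hα : α.IsNonZero) :
    cartanInt α (reflectRoot α β) =
      -cartanInt α β := by
  have h := reflectRoot_apply_coroot α β hα
  rw [apply_coroot_eq_cartanInt, apply_coroot_eq_cartanInt] at h
  exact_mod_cast h

/-- For each positive root `α`, the sum of all `⟨β, α^∨⟩`, `β` positive, is positive. Reason: if
`⟨β, α^∨⟩ < 0` then the `α`-string from `β` to its reflection in `α` stays inside the positive
system, so the reflection cancels the negative terms against positive ones, and it leaves out the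
term of `α` itself. -/
theorem PositiveSystem.sum_cartanInt_pos (P : PositiveSystem 𝔧) (α : Weight ℂ 𝔧 𝔤)
    (hα : α.toLinear ∈ P.roots) :
    0 < ∑ β ∈ P.weights, cartanInt α β := by
  classical
  have hα0 := (isRoot_toLinear_iff α).mp (P.isRoot _ hα)
  set m : Weight ℂ 𝔧 𝔤 → ℤ := cartanInt α with hm
  have hmα : m α = 2 := by
    have h1 := root_apply_coroot hα0
    rw [apply_coroot_eq_cartanInt] at h1
    exact_mod_cast h1
  have hms : ∀ β, m (reflectRoot α β) = -m β := fun β => cartanInt_reflectRoot α β hα0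
  rw [← Finset.sum_filter_add_sum_filter_not P.weights (fun β => m β < 0)]
  set N := P.weights.filter fun β => m β < 0
  set Q := P.weights.filter fun β => ¬ m β < 0
  -- The reflection carries the negative terms to positive ones, none of which is that of `α`.
  have hsub : N.image (reflectRoot α) ⊆ Q.erase α := by
    intro γ hγ
    obtain ⟨β, hβ, rfl⟩ := Finset.mem_image.mp hγ
    obtain ⟨hβP, hβm⟩ := Finset.mem_filter.mp hβ
    rw [P.mem_weights] at hβP
    refine Finset.mem_erase.mpr ⟨fun h => ?_, Finset.mem_filter.mpr ⟨P.mem_weights.mpr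
      (P.reflectRoot_mem_roots α β hα hβP ?_), ?_⟩⟩
    · have hβα : m β = -2 := by
        have := hms β
        rw [h, hmα] at this
        omega
      have hneg : -α.toLinear = β.toLinear := by
        ext x
        have h2 : β x - β (coroot α) * α x = α x := congrArg (fun w : Weight ℂ 𝔧 𝔤 => w x) h
        have h3 : β (coroot α) = -2 := by
          rw [apply_coroot_eq_cartanInt]; exact_mod_cast hβα
        rw [h3] at h2
        rw [LinearMap.neg_apply, Weight.toLinear_apply, Weight.toLinear_apply]
        linear_combination -h2
      exact P.neg_notMem _ hα (hneg ▸ hβP)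
    · simp only [hm, cartanInt] at hβm
      omega
    · rw [hms]; omega
  have hQα : α ∈ Q := Finset.mem_filter.mpr ⟨P.mem_weights.mpr hα, by rw [hmα]; norm_num⟩
  have h1 : ∑ γ ∈ N.image (reflectRoot α), m γ ≤ ∑ γ ∈ Q.erase α, m γ :=
    Finset.sum_le_sum_of_subset_of_nonneg hsub fun γ hγ _ =>
      not_lt.mp (Finset.mem_filter.mp (Finset.mem_of_mem_erase hγ)).2
  rw [Finset.sum_image fun _ _ _ _ h => reflectRoot_injective α hα0 h] at h1
  simp only [hms, Finset.sum_neg_distrib] at h1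
  have h2 := Finset.add_sum_erase Q m hQα
  change 0 < ∑ β ∈ N, m β + ∑ β ∈ Q, m β
  omega

/-- The squared length of a root is positive rational: it is `4` divided by the squared length of
the coroot for the Killing form, which is a sum of squares of integers. -/
theorem exists_root_apply_cartanEquivDual_symm_eq (α : Weight ℂ 𝔧 𝔤) (hα : α.IsNonZero) :
    ∃ n : ℕ, 0 < n ∧ α ((cartanEquivDual 𝔧).symm α) = 4 / (n : ℂ) := by
  have h0 := root_apply_cartanEquivDual_symm_ne_zero hα
  have h1 := traceForm_coroot α (coroot α)
  rw [root_apply_coroot hα] at h1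
  have h2 : traceForm ℂ 𝔧 𝔤 (coroot α) (coroot α) =
      ((∑ γ : Weight ℂ 𝔧 𝔤, finrank ℂ (genWeightSpace 𝔤 γ) *
        (cartanInt α γ).natAbs ^ 2 : ℕ) : ℂ) := by
    rw [traceForm_eq_sum_finrank_nsmul_mul, Nat.cast_sum]
    refine Finset.sum_congr rfl fun γ _ => ?_
    rw [apply_coroot_eq_cartanInt, nsmul_eq_mul, Nat.cast_mul, ← sq]
    congr 1
    rw [← Int.cast_natCast (R := ℂ), ← Int.cast_pow, Nat.cast_pow, Int.natAbs_sq]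
  rw [h2] at h1
  set n := ∑ γ : Weight ℂ 𝔧 𝔤, finrank ℂ (genWeightSpace 𝔤 γ) *
        (cartanInt α γ).natAbs ^ 2
  have h3 : (n : ℂ) * α ((cartanEquivDual 𝔧).symm α) = 4 := by
    rw [h1, nsmul_eq_mul, smul_eq_mul]
    field_simp
    norm_num
  have hn : (n : ℂ) ≠ 0 := fun h => by rw [h, zero_mul] at h3; norm_num at h3
  exact ⟨n, Nat.pos_of_ne_zero (by exact_mod_cast hn), by rw [eq_div_iff hn, mul_comm, h3]⟩

/-- The sum of the positive roots, transported to `𝔧` by the Killing form, is dominant regular. -/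
theorem PositiveSystem.exists_re_pos (P : PositiveSystem 𝔧) :
    ∃ h : 𝔧, ∀ α ∈ P.roots, 0 < (α h).re := by
  refine ⟨∑ β ∈ P.weights, (cartanEquivDual 𝔧).symm (β.toLinear : Dual ℂ 𝔧), fun α' hα' => ?_⟩
  obtain ⟨α, rfl⟩ : ∃ α : Weight ℂ 𝔧 𝔤, α.toLinear = α' := ⟨(P.isRoot _ hα').weight, rfl⟩
  have hα0 := (isRoot_toLinear_iff α).mp (P.isRoot _ hα')
  obtain ⟨n, hn, hαα⟩ := exists_root_apply_cartanEquivDual_symm_eq α hα0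
  have hsymm : ∀ β : Weight ℂ 𝔧 𝔤,
      (α.toLinear : Dual ℂ 𝔧) ((cartanEquivDual 𝔧).symm (β.toLinear : Dual ℂ 𝔧)) =
        2 / (n : ℂ) * cartanInt α β := by
    intro β
    have h1 := traceForm_coroot α ((cartanEquivDual 𝔧).symm (β.toLinear : Dual ℂ 𝔧))
    have h2 : β (coroot α) =
        traceForm ℂ 𝔧 𝔤 (coroot α) ((cartanEquivDual 𝔧).symm (β.toLinear : Dual ℂ 𝔧)) := by
      rw [traceForm_comm]
      exact (LinearMap.congr_fun ((cartanEquivDual 𝔧).apply_symm_apply β.toLinear)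
        (coroot α)).symm
    rw [← h2, apply_coroot_eq_cartanInt, hαα, nsmul_eq_mul, smul_eq_mul] at h1
    rw [h1, Weight.toLinear_apply]
    have : (n : ℂ) ≠ 0 := by exact_mod_cast hn.ne'
    field_simp
    push_cast
    ring
  have hpos := P.sum_cartanInt_pos α hα'
  rw [map_sum, Finset.sum_congr rfl fun β _ => hsymm β, ← Finset.mul_sum]
  rw [← Int.cast_sum]
  have : (2 / (n : ℂ) * ((∑ β ∈ P.weights, cartanInt α β : ℤ) : ℂ)) =
      ((2 / (n : ℝ) * ((∑ β ∈ P.weights, cartanInt α β : ℤ) : ℝ)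
        : ℝ) : ℂ) := by push_cast; rfl
  rw [this, Complex.ofReal_re]
  positivity

/-- There is a dominant regular element, normalized so that all positive roots have real part at
least `1` on it. -/
theorem PositiveSystem.exists_one_le_re (P : PositiveSystem 𝔧) :
    ∃ h : 𝔧, ∀ α ∈ P.roots, 1 ≤ (α h).re := by
  obtain ⟨h, hh⟩ := P.exists_re_pos
  obtain ⟨δ, hδ, hle⟩ : ∃ δ : ℝ, 0 < δ ∧ ∀ α ∈ P.weights, δ ≤ (α h).re := by
    rcases P.weights.eq_empty_or_nonempty with h0 | h0
    · exact ⟨1, one_pos, by simp [h0]⟩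
    · obtain ⟨β, hβ, hmin⟩ := P.weights.exists_min_image (fun α => (α h).re) h0
      exact ⟨_, hh _ (P.mem_weights.mp hβ), hmin⟩
  refine ⟨((δ⁻¹ : ℝ) : ℂ) • h, fun α hα => ?_⟩
  have h1 : δ ≤ (α h).re := hle (P.isRoot _ hα).weight (P.mem_weights.mpr hα)
  rw [map_smul, smul_eq_mul, Complex.re_ofReal_mul]
  exact (one_le_inv_mul₀ hδ).mpr h1

end PositiveSystem

end BGG

/-! ### Eigenvalues on a Lie algebra and on its quotient by a subalgebra -/

section Triangular

open LieModule Module.End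

variable {L : Type*} [LieRing L] [LieAlgebra ℂ L] [FiniteDimensional ℂ L]

theorem Module.End.exists_genEigenspaceReLE_eq_bot {V : Type*} [AddCommGroup V] [Module ℂ V]
    [FiniteDimensional ℂ V] (T : End ℂ V) : ∃ k : ℕ, T.genEigenspaceReLE (-k) = ⊥ := by
  obtain ⟨r, hr⟩ := ((finite_spectrum T).image Complex.re).bddBelow
  obtain ⟨k, hk⟩ := exists_nat_gt (-r)
  refine ⟨k, eq_bot_iff.mpr (iSup₂_le fun μ hμ => le_of_eq ?_)⟩
  by_contra hne
  have : T.HasEigenvalue μ := HasUnifEigenvalue.lt (k := ⊤) zero_lt_one hne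
  have := hr ⟨μ, hasEigenvalue_iff_mem_spectrum.mp this, rfl⟩
  linarith

/-- A subalgebra that `ad t` filters by nonpositive real parts, with brackets of real part at most
`-1`, is solvable: the real parts on its derived series tend to `-∞`. -/
theorem LieSubalgebra.isSolvable_of_genEigenspaceReLE (B : LieSubalgebra ℂ L) (t : L)
    (h0 : ∀ b ∈ B, b ∈ (toEnd ℂ L L t).genEigenspaceReLE 0)
    (h1 : ∀ a ∈ B, ∀ b ∈ B, ⁅a, b⁆ ∈ (toEnd ℂ L L t).genEigenspaceReLE (-1)) :
    LieAlgebra.IsSolvable B := by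
  let I : ℝ → LieIdeal ℂ B := fun r =>
    { toSubmodule := ((toEnd ℂ L L t).genEigenspaceReLE r).comap B.toSubmodule.subtype
      lie_mem := by
        intro b y hy
        have := lie_mem_genEigenspaceReLE t (h0 b b.2) hy
        rwa [zero_add] at this }
  have hI : ∀ k : ℕ, LieAlgebra.derivedSeries ℂ B (k + 1) ≤ I (-(k + 1 : ℕ)) := by
    intro k
    induction k with
    | zero =>
      rw [LieAlgebra.derivedSeries_def, LieAlgebra.derivedSeriesOfIdeal_succ,
        LieSubmodule.lie_le_iff]
      intro a _ b _
      exact genEigenspaceReLE_mono _ (by norm_num) (h1 a a.2 b b.2)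
    | succ k ih =>
      rw [LieAlgebra.derivedSeries_def, LieAlgebra.derivedSeriesOfIdeal_succ,
        LieSubmodule.lie_le_iff]
      intro a ha b hb
      refine genEigenspaceReLE_mono _ ?_ (lie_mem_genEigenspaceReLE t (ih ha) (ih hb))
      push_cast
      linarith [(Nat.cast_nonneg k : (0 : ℝ) ≤ k)]
  obtain ⟨k, hk⟩ := (toEnd ℂ L L t).exists_genEigenspaceReLE_eq_bot
  refine (LieAlgebra.isSolvable_iff ℂ B).mpr ⟨k + 1, (LieSubmodule.eq_bot_iff _).mpr fun y hy => ?_⟩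
  have hy' : (y : L) ∈ (toEnd ℂ L L t).genEigenspaceReLE (-k) :=
    genEigenspaceReLE_mono _ (by push_cast; linarith) (hI k hy)
  rw [hk, Submodule.mem_bot] at hy'
  exact Subtype.ext hy'

/-- If `z ∈ B` acts on `L / B` with eigenvalues of negative real part, then `L` is spanned by `B`
and the generalized eigenvectors of `ad z` with real part at most some `-δ < 0`. -/
theorem LieSubalgebra.exists_sup_genEigenspaceReLE_eq_top (B : LieSubalgebra ℂ L) (z : B)
    (hz : ∀ μ, (toEnd ℂ B (L ⧸ B.toLieSubmodule) z).HasEigenvalue μ → μ.re < 0) :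
    ∃ δ : ℝ, 0 < δ ∧ B.toSubmodule ⊔ (toEnd ℂ L L (z : L)).genEigenspaceReLE (-δ) = ⊤ := by
  set T := toEnd ℂ L L (z : L)
  obtain ⟨δ, hδ, hle⟩ : ∃ δ : ℝ, 0 < δ ∧ ∀ μ, T.HasEigenvalue μ → μ.re < 0 → μ.re ≤ -δ := by
    have hfin : {μ : ℂ | T.HasEigenvalue μ ∧ μ.re < 0}.Finite :=
      (finite_spectrum T).subset fun μ h => hasEigenvalue_iff_mem_spectrum.mp h.1
    rcases Set.eq_empty_or_nonempty {μ : ℂ | T.HasEigenvalue μ ∧ μ.re < 0} with h0 | h0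
    · exact ⟨1, one_pos, fun μ h h' => (h0.subset ⟨h, h'⟩).elim⟩
    · obtain ⟨ν, hν, hmax⟩ := Set.exists_max_image _ Complex.re hfin h0
      exact ⟨-ν.re, neg_pos.mpr hν.2, fun μ h h' => by rw [neg_neg]; exact hmax μ ⟨h, h'⟩⟩
  refine ⟨δ, hδ, eq_top_iff.mpr ?_⟩
  rw [← iSup_maxGenEigenspace_eq_top T]
  refine iSup_le fun μ => ?_
  by_cases hbot : T.maxGenEigenspace μ = ⊥
  · rw [hbot]; exact bot_le
  have hμ : T.HasEigenvalue μ := HasUnifEigenvalue.lt (k := ⊤) zero_lt_one hbot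
  by_cases hre : μ.re < 0
  · exact le_sup_of_le_right (T.maxGenEigenspace_le_genEigenspaceReLE (hle μ hμ hre))
  · refine le_sup_of_le_left fun y hy => ?_
    have h1 : (toEnd ℂ B (L ⧸ B.toLieSubmodule) z).maxGenEigenspace μ = ⊥ := by
      by_contra hne
      exact hre (hz μ (HasUnifEigenvalue.lt (k := ⊤) zero_lt_one hne))
    have h2 := apply_mem_maxGenEigenspace (T' := toEnd ℂ B (L ⧸ B.toLieSubmodule) z)
      (LieSubmodule.Quotient.mk' B.toLieSubmodule : L →ₗ[ℂ] L ⧸ B.toLieSubmodule)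
      (fun v => LieModuleHom.map_lie (LieSubmodule.Quotient.mk' B.toLieSubmodule) z v) hy
    rw [h1, Submodule.mem_bot] at h2
    exact (LieSubmodule.Quotient.mk_eq_zero (N := B.toLieSubmodule)).mp h2

end Triangular

/-! ### The Borel subalgebra and its fixed elements -/

namespace BGG

open LieModule Module.End LieAlgebra

variable {𝔤 : Type*} [LieRing 𝔤] [LieAlgebra ℂ 𝔤] [FiniteDimensional ℂ 𝔤]
  {𝔧 : LieSubalgebra ℂ 𝔤} [𝔧.IsCartanSubalgebra]

section Borel

variable [IsKilling ℂ 𝔤]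

theorem rootSpace_le_maxGenEigenspace (α : 𝔧 → ℂ) (h : 𝔧) (c : ℂ) {x : 𝔤}
    (hx : x ∈ rootSpace 𝔧 α) :
    x ∈ (toEnd ℂ 𝔤 𝔤 (c • (h : 𝔤))).maxGenEigenspace (c * α h) := by
  refine eigenspace_le_maxGenEigenspace ?_
  rw [mem_eigenspace_iff, toEnd_apply_apply, smul_lie, mul_smul]
  congr 1
  exact IsKilling.lie_eq_smul_of_mem_rootSpace hx h

theorem PositiveSystem.isSolvable_borel (P : PositiveSystem 𝔧) : IsSolvable P.borel := by
  obtain ⟨h, hh⟩ := P.exists_one_le_re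
  -- With this sign, positive root spaces have negative eigenvalues.
  set t : 𝔤 := (-1 : ℂ) • (h : 𝔤)
  have hn : P.rootSum.toSubmodule ≤ (toEnd ℂ 𝔤 𝔤 t).genEigenspaceReLE (-1) := by
    rw [PositiveSystem.rootSum]
    simp only [LieSubmodule.iSup_toSubmodule]
    refine iSup₂_le fun α hα x hx => ?_
    refine maxGenEigenspace_le_genEigenspaceReLE _ ?_ (rootSpace_le_maxGenEigenspace _ h (-1) hx)
    have := hh α hα
    simp only [neg_mul, one_mul, Complex.neg_re]
    linarith
  have habel : ∀ a ∈ 𝔧, ∀ b ∈ 𝔧, ⁅a, b⁆ = 0 := fun a ha b hb =>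
    congrArg Subtype.val (trivial_lie_zero 𝔧 𝔧 ⟨a, ha⟩ ⟨b, hb⟩)
  refine P.borel.isSolvable_of_genEigenspaceReLE t ?_ ?_
  · intro x hx
    obtain ⟨a, ha, u, hu, rfl⟩ := Submodule.mem_sup.mp hx
    refine add_mem ?_ (genEigenspaceReLE_mono _ (by norm_num) (hn hu))
    refine maxGenEigenspace_le_genEigenspaceReLE _ (μ := 0) (by simp) ?_
    refine eigenspace_le_maxGenEigenspace ?_
    rw [mem_eigenspace_iff, toEnd_apply_apply, smul_lie, habel _ h.2 a ha, smul_zero, zero_smul]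
  · intro x hx y hy
    obtain ⟨a, ha, u, hu, rfl⟩ := Submodule.mem_sup.mp hx
    obtain ⟨b, hb, v, hv, rfl⟩ := Submodule.mem_sup.mp hy
    have h2 : ⁅a, v⁆ ∈ P.rootSum.toSubmodule := P.rootSum.lie_mem (x := ⟨a, ha⟩) hv
    have h3 : ⁅u, b⁆ ∈ P.rootSum.toSubmodule := by
      rw [← lie_skew]
      exact neg_mem (S := LieSubmodule ℂ 𝔧 𝔤) (P.rootSum.lie_mem (x := ⟨b, hb⟩) hu)
    have h4 : ⁅u, v⁆ ∈ P.rootSum.toSubmodule := P.lie_mem_rootSum hu hv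
    rw [add_lie, lie_add, lie_add, habel a ha b hb, zero_add]
    exact hn (add_mem h2 (add_mem h3 h4))

omit [FiniteDimensional ℂ 𝔤] [IsKilling ℂ 𝔤] in
theorem PositiveSystem.cartan_le_borel (P : PositiveSystem 𝔧) {x : 𝔤} (hx : x ∈ 𝔧) :
    x ∈ P.borel := Submodule.mem_sup_left hx

theorem PositiveSystem.re_neg_of_hasEigenvalue_quotient_borel (P : PositiveSystem 𝔧) (h : 𝔧)
    (hh : ∀ α ∈ P.roots, 1 ≤ (α h).re) (μ : ℂ)
    (hμ : (toEnd ℂ P.borel (𝔤 ⧸ P.borel.toLieSubmodule)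
      ⟨h, P.cartan_le_borel h.2⟩).HasEigenvalue μ) : μ.re < 0 := by
  set T := toEnd ℂ P.borel (𝔤 ⧸ P.borel.toLieSubmodule) ⟨h, P.cartan_le_borel h.2⟩
  let π : 𝔤 →ₗ[ℂ] 𝔤 ⧸ P.borel.toLieSubmodule :=
    LieSubmodule.Quotient.mk' P.borel.toLieSubmodule
  have hπ : ∀ x ∈ P.borel, π x = 0 := fun x hx =>
    (LieSubmodule.Quotient.mk_eq_zero (N := P.borel.toLieSubmodule)).mpr hx
  have htop : T.genEigenspaceReLE (-1) = ⊤ := by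
    have hle : ∀ x : 𝔤, π x ∈ T.genEigenspaceReLE (-1) := by
      have h1 : (⊤ : Submodule ℂ 𝔤) ≤ (T.genEigenspaceReLE (-1)).comap π := by
        rw [← LieSubmodule.top_toSubmodule (L := 𝔧), ← iSup_genWeightSpace_eq_top' ℂ 𝔧 𝔤,
          LieSubmodule.iSup_toSubmodule]
        refine iSup_le fun α x hx => ?_
        rw [Submodule.mem_comap]
        by_cases hα : α.IsZero
        · have hx' : x ∈ rootSpace 𝔧 (0 : 𝔧 → ℂ) := by
            have : (α : 𝔧 → ℂ) = 0 := hα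
            rwa [← this]
          rw [rootSpace_zero_eq] at hx'
          rw [hπ x (P.cartan_le_borel hx')]
          exact zero_mem _
        · rcases P.mem_or_neg_mem _ ((isRoot_toLinear_iff α).mpr hα) with hP | hP
          · rw [hπ x (Submodule.mem_sup_right ?_)]
            · exact zero_mem _
            · exact (le_iSup₂_of_le (f := fun γ (_ : γ ∈ P.roots) => rootSpace 𝔧 γ)
                _ hP le_rfl) hx
          · have h2 := rootSpace_le_maxGenEigenspace α h 1 hx
            rw [one_smul, one_mul] at h2
            refine maxGenEigenspace_le_genEigenspaceReLE _ ?_ (apply_mem_maxGenEigenspace π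
              (fun v => LieModuleHom.map_lie (LieSubmodule.Quotient.mk' P.borel.toLieSubmodule)
                ⟨h, P.cartan_le_borel h.2⟩ v) h2)
            have h3 := hh _ hP
            rw [LinearMap.neg_apply, Complex.neg_re, Weight.toLinear_apply] at h3
            linarith
      exact fun x => h1 Submodule.mem_top
    rw [eq_top_iff]
    intro q _
    obtain ⟨x, rfl⟩ := LieSubmodule.Quotient.surjective_mk' P.borel.toLieSubmodule q
    exact hle x
  by_contra hre
  have hdis := T.disjoint_maxGenEigenspace_genEigenspaceReLE (μ := μ) (r := -1) (by linarith)
  rw [htop, disjoint_top] at hdis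
  exact hμ (eq_bot_iff.mpr fun q hq => by
    have := eigenspace_le_maxGenEigenspace hq
    rwa [hdis] at this)

/-- If `τ` stabilizes the Borel subalgebra and `h` is dominant regular, then `h + τ h` still acts
on `𝔤 / 𝔟` with eigenvalues of negative real part: `τ` identifies the actions of `h` and `τ h`
on `𝔤 / 𝔟`, and by Lie's theorem the solvable algebra `𝔟` acts there by triangular matrices. -/
theorem PositiveSystem.exists_fixed_sup_genEigenspaceReLE_eq_top (P : PositiveSystem 𝔧)
    (τ : 𝔤 ≃ₗ⁅ℂ⁆ 𝔤) (hτ : ∀ x, τ (τ x) = x)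
    (hstable : P.borel.map (τ : 𝔤 →ₗ⁅ℂ⁆ 𝔤) = P.borel) :
    ∃ z ∈ P.borel, τ z = z ∧ ∃ δ : ℝ, 0 < δ ∧
      P.borel.toSubmodule ⊔ (toEnd ℂ 𝔤 𝔤 z).genEigenspaceReLE (-δ) = ⊤ := by
  obtain ⟨h, hh⟩ := P.exists_one_le_re
  have := P.isSolvable_borel
  have hτB : ∀ x ∈ P.borel, τ x ∈ P.borel := fun x hx => by
    rw [← hstable]
    exact (LieSubalgebra.mem_map (τ : 𝔤 →ₗ⁅ℂ⁆ 𝔤) P.borel (τ x)).mpr ⟨x, hx, rfl⟩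
  let a : P.borel := ⟨h, P.cartan_le_borel h.2⟩
  let b : P.borel := ⟨τ h, hτB _ (P.cartan_le_borel h.2)⟩
  have ha : ∀ μ, (toEnd ℂ P.borel (𝔤 ⧸ P.borel.toLieSubmodule) a).HasEigenvalue μ → μ.re < 0 :=
    P.re_neg_of_hasEigenvalue_quotient_borel h hh
  let σ : (𝔤 ⧸ P.borel.toLieSubmodule) →ₗ[ℂ] (𝔤 ⧸ P.borel.toLieSubmodule) :=
    Submodule.mapQ P.borel.toSubmodule P.borel.toSubmodule (τ : 𝔤 →ₗ[ℂ] 𝔤) hτB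
  have hσ : ∀ x : 𝔤, σ (LieSubmodule.Quotient.mk' P.borel.toLieSubmodule x) =
      LieSubmodule.Quotient.mk' P.borel.toLieSubmodule (τ x) := fun _ => rfl
  have hb : ∀ μ, (toEnd ℂ P.borel (𝔤 ⧸ P.borel.toLieSubmodule) b).HasEigenvalue μ →
      μ.re < 0 := by
    intro μ hμ
    refine ha μ (hμ.of_surjective σ ?_ ?_)
    · intro q
      obtain ⟨x, rfl⟩ := LieSubmodule.Quotient.surjective_mk' P.borel.toLieSubmodule q
      rw [toEnd_apply_apply, toEnd_apply_apply, hσ, ← LieModuleHom.map_lie,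
        ← LieModuleHom.map_lie, hσ]
      congr 1
      exact τ.map_lie h x
    · intro q
      obtain ⟨x, rfl⟩ := LieSubmodule.Quotient.surjective_mk' P.borel.toLieSubmodule q
      exact ⟨LieSubmodule.Quotient.mk' _ (τ x), by rw [hσ, hτ]⟩
  exact ⟨(a + b : P.borel), (a + b).2, by
    change τ (h + τ h) = h + τ h
    rw [map_add, hτ, add_comm],
    P.borel.exists_sup_genEigenspaceReLE_eq_top (a + b)
      (re_neg_of_hasEigenvalue_add P.borel a b _ ha hb)⟩

end Borel

omit [FiniteDimensional ℂ 𝔤] in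
/-- A simple object of category `𝒪` is generated by a finite-dimensional `𝔟`-stable subspace:
the `𝔫`-submodule generated by a weight vector. -/
theorem CategoryO.exists_stable_generating {P : PositiveSystem 𝔧} {X : Type*} [AddCommGroup X]
    [Module ℂ X] [LieRingModule 𝔤 X] [LieModule ℂ 𝔤 X] (hX : CategoryO P X)
    [LieModule.IsIrreducible ℂ 𝔤 X] :
    ∃ V₀ : Submodule ℂ X, FiniteDimensional ℂ V₀ ∧ (∀ b ∈ P.borel, ∀ v ∈ V₀, ⁅b, v⁆ ∈ V₀) ∧
      LieSubmodule.lieSpan ℂ 𝔤 (V₀ : Set X) = ⊤ := by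
  have : Nontrivial X := (LieSubmodule.nontrivial_iff ℂ 𝔤 X).mp inferInstance
  obtain ⟨χ, hχ⟩ : ∃ χ : Module.Dual ℂ 𝔧, weightSpace X (χ : 𝔧 → ℂ) ≠ ⊥ := by
    by_contra! hno
    have := hX.semisimple
    simp only [hno, iSup_bot] at this
    exact bot_ne_top this
  obtain ⟨v, hv, hv0⟩ := Submodule.exists_mem_ne_zero_of_ne_bot
    (fun h => hχ ((LieSubmodule.toSubmodule_eq_bot _).mp h))
  rw [LieSubmodule.mem_toSubmodule] at hv
  rw [mem_weightSpace] at hv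
  set S := LieSubmodule.lieSpan ℂ P.nilradical ({v} : Set X)
  have hvS : v ∈ S := LieSubmodule.subset_lieSpan rfl
  -- The elements of `S` that `𝔧` keeps inside `S` form an `𝔫`-submodule containing `v`.
  let S' : LieSubmodule ℂ P.nilradical X :=
    { carrier := {w | w ∈ S ∧ ∀ a ∈ 𝔧, ⁅a, w⁆ ∈ S}
      add_mem' := fun {x y} hx hy => ⟨add_mem hx.1 hy.1, fun a ha => by
        rw [lie_add]; exact add_mem (hx.2 a ha) (hy.2 a ha)⟩
      zero_mem' := ⟨zero_mem _, fun a _ => by rw [lie_zero]; exact zero_mem _⟩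
      smul_mem' := fun c x hx => ⟨S.smul_mem c hx.1, fun a ha => by
        rw [lie_smul]; exact S.smul_mem c (hx.2 a ha)⟩
      lie_mem := fun {n w} hw => ⟨S.lie_mem hw.1, fun a ha => by
        change ⁅a, ⁅(n : 𝔤), w⁆⁆ ∈ S
        rw [leibniz_lie]
        have h1 : ⁅a, (n : 𝔤)⁆ ∈ P.nilradical := P.rootSum.lie_mem (x := ⟨a, ha⟩) n.2
        exact add_mem (S.lie_mem (x := ⟨_, h1⟩) hw.1) (S.lie_mem (x := n) (hw.2 a ha))⟩ }
  have hSS' : S ≤ S' := by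
    refine LieSubmodule.lieSpan_le.mpr (Set.singleton_subset_iff.mpr ⟨hvS, fun a ha => ?_⟩)
    have : ⁅a, v⁆ = χ ⟨a, ha⟩ • v := hv ⟨a, ha⟩
    rw [this]
    exact S.smul_mem _ hvS
  refine ⟨S.toSubmodule, hX.locallyFinite v, fun b hb w hw => ?_, ?_⟩
  · obtain ⟨a, ha, n, hn, rfl⟩ := Submodule.mem_sup.mp hb
    rw [add_lie]
    exact add_mem ((hSS' hw).2 a ha) (S.lie_mem (x := ⟨n, hn⟩) hw)
  · refine (eq_bot_or_eq_top _).resolve_left fun h => hv0 ?_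
    have : v ∈ LieSubmodule.lieSpan ℂ 𝔤 (S.toSubmodule : Set X) :=
      LieSubmodule.subset_lieSpan hvS
    rw [h] at this
    simpa using this

end BGG

theorem theorem4p9 {𝔤 : Type*} [LieRing 𝔤] [LieAlgebra ℂ 𝔤] [FiniteDimensional ℂ 𝔤]
    [LieAlgebra.IsSemisimple ℂ 𝔤]
    (τ : 𝔤 ≃ₗ⁅ℂ⁆ 𝔤) (hτ : ∀ x, τ (τ x) = x)
    (𝔧 : LieSubalgebra ℂ 𝔤) [𝔧.IsCartanSubalgebra] (P : BGG.PositiveSystem 𝔧)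
    (hstable : P.borel.map (τ : 𝔤 →ₗ⁅ℂ⁆ 𝔤) = P.borel)
    (X : Type*) [AddCommGroup X] [Module ℂ X] [LieRingModule 𝔤 X] [LieModule ℂ 𝔤 X]
    (hX : BGG.CategoryO P X) (hXsimple : LieModule.IsIrreducible ℂ 𝔤 X)
    (Y : Type*) [AddCommGroup Y] [Module ℂ Y] [LieRingModule (BGG.fixedSubalgebra τ) Y]
    [LieModule ℂ (BGG.fixedSubalgebra τ) Y]
    (hYsimple : LieModule.IsIrreducible ℂ (BGG.fixedSubalgebra τ) Y) :
    FiniteDimensional ℂ (Y →ₗ⁅ℂ, BGG.fixedSubalgebra τ⁆ X) ∧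
      BGG.subquotientMultiplicity (BGG.fixedSubalgebra τ) Y X < ⊤ := by
  obtain ⟨z, hzB, hzτ, δ, hδ, hz⟩ := P.exists_fixed_sup_genEigenspaceReLE_eq_top τ hτ hstable
  obtain ⟨V₀, _, hV₀, hgen⟩ := hX.exists_stable_generating
  obtain ⟨hlf, hfd⟩ :=
    LieModule.isLocallyFinite_and_finiteDimensional P.borel hzB hδ hz hV₀ hgen
  let z' : BGG.fixedSubalgebra τ := ⟨z, hzτ⟩
  exact ⟨LieModuleHom.finiteDimensional_of_isLocallyFinite z' hlf hfd,
    BGG.subquotientMultiplicity_lt_top z' hlf hfd⟩
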